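/- All graphs are finite and may have loops and parallel edges. A \emph{biased graph} $(G,\mathcal B)$ is a graph $G$ with a set $\mathcal B$ of cycles of $G$ (called balanced) such that no theta subgraph of $G$ (two distinct vertices joined by three internally disjoint paths) contains exactly two cycles of $\mathcal B$. For a group $\Gamma$, an orientation of $G$ and a map $\phi:E(G)\to\Gamma$, let $\phi(W)$, for a walk $W$, be the product in order of the labels of its edges, inverted at the edges traversed backward, and let $\mathcal B_\phi$ be the set of cycles $C$ such that some simple closed walk $W$ around $C$ satisfies $\phi(W)=1$; the biased graph $(G,\mathcal B_\phi)$ is called \emph{$\Gamma$-labelled}. \emph{Deleting} an edge $e$ from $(G,\mathcal B)$ deletes $e$ from $G$ and removes from $\mathcal B$ every cycle containing $e$. \emph{Contracting} a balanced loop means deleting it. Contracting a non-loop edge $e$ contracts $e$ in $G$ and declares a cycle $C$ of $G/e$ balanced if $C\in\mathcal B$ or $E(C)\cup\{e\}$ is the edge set of a cycle in $\mathcal B$. For unbalanced loops $e$, with end $v$, fix one of three conventions: (i) they may not be contracted; (ii) (lift) contracting $e$ deletes $e$ and makes all cycles balanced; (iii) (frame) contracting $e$ deletes $e$, replaces each edge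 joining $v$ to another vertex $x$ by an unbalanced loop at $x$, and makes every other loop at $v$ balanced, all other cycles keeping their status. A \emph{minor} of $(G,\mathcal B)$ is a biased graph obtained by a finite sequence of deletions and contractions. An \emph{antichain} is a set of biased graphs no one of which is isomorphic to a minor of another. \textbf{Theorem.} Let $\Gamma$ be a group and let $t\ge 3$ be an integer. Under each of the three conventions, there exists an infinite antichain of $\Gamma$-labelled biased graphs, each on exactly $t$ vertices, if and only if $\Gamma$ is infinite. -/

import Mathlib

open scoped Graph

namespace Graph

variable {α β : Type*}

/-- `G.IsWalk x w y`: `w` is a walk of the multigraph `G` from `x` to `y`. The walk is recorded as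
the list of its steps `(e, z)`, where `e` is the edge traversed and `z` is the vertex reached. -/
inductive IsWalk (G : Graph α β) : α → List (β × α) → α → Prop
  | nil {x : α} (hx : x ∈ V(G)) : IsWalk G x [] x
  | cons {e : β} {x y z : α} {w : List (β × α)} (h : G.IsLink e x y) (hw : IsWalk G y w z) :
      IsWalk G x ((e, y) :: w) z

/-- A path: a walk that repeats no vertex. -/
def IsPath (G : Graph α β) (x : α) (w : List (β × α)) (y : α) : Prop :=
  G.IsWalk x w y ∧ (x :: w.map Prod.snd).Nodup

/-- A simple closed walk: a nonempty closed walk that repeats no edge, and repeats no vertex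
except that its last vertex is its first one. (A loop gives one of length 1, a pair of parallel
edges gives one of length 2.) -/
def IsSimpleClosedWalk (G : Graph α β) (x : α) (w : List (β × α)) : Prop :=
  G.IsWalk x w x ∧ w ≠ [] ∧ (w.map Prod.snd).Nodup ∧ (w.map Prod.fst).Nodup

/-- The set of edges of a walk. -/
def walkEdges (w : List (β × α)) : Set β := {e | e ∈ w.map Prod.fst}

/-- The internal vertices of a path given by its list of steps. -/
def walkInterior (w : List (β × α)) : List α := (w.map Prod.snd).dropLast

/-- `C` is (the edge set of) a cycle of `G`. Cycles are identified with their edge sets. -/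
def IsCycle (G : Graph α β) (C : Set β) : Prop :=
  ∃ x w, G.IsSimpleClosedWalk x w ∧ walkEdges w = C

/-- `A`, `B`, `C` are the edge sets of the three internally disjoint paths, joining two distinct
vertices, of a theta subgraph of `G`. Its three cycles are `A ∪ B`, `B ∪ C` and `A ∪ C`. -/
def IsTheta (G : Graph α β) (A B C : Set β) : Prop :=
  ∃ (x y : α) (p q r : List (β × α)), x ≠ y ∧
    G.IsPath x p y ∧ G.IsPath x q y ∧ G.IsPath x r y ∧
    (walkInterior p).Disjoint (walkInterior q) ∧
    (walkInterior q).Disjoint (walkInterior r) ∧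
    (walkInterior p).Disjoint (walkInterior r) ∧
    walkEdges p = A ∧ walkEdges q = B ∧ walkEdges r = C ∧
    Disjoint A B ∧ Disjoint B C ∧ Disjoint A C

open Classical in
/-- Contraction of the non-loop edge `e` with ends `x` and `y`: the edge `e` is removed and
the vertex `y` is identified with `x`. -/
noncomputable def contractLink (G : Graph α β) (e : β) (x y : α) : Graph α β :=
  (G.deleteEdges {e}).map (fun v => if v = y then x else v)

end Graph

/-- A (finite) biased graph with vertices in `α` and edges in `β`: a finite multigraph with
a set of cycles, called balanced, such that no theta subgraph has exactly two balanced cycles. -/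
structure BiasedGraph (α β : Type*) where
  graph : Graph α β
  finite_vertexSet : V(graph).Finite
  finite_edgeSet : E(graph).Finite
  /-- The edge sets of the balanced cycles. -/
  balanced : Set (Set β)
  isCycle_of_balanced : ∀ C ∈ balanced, graph.IsCycle C
  /-- The three paths of a theta may be permuted, so this excludes exactly two balanced cycles. -/
  theta : ∀ A B C : Set β, graph.IsTheta A B C →
    A ∪ B ∈ balanced → B ∪ C ∈ balanced → A ∪ C ∈ balanced

/-- A group labelling of `G`: an orientation of the edges together with a map to the group.
Values outside the edge set of `G` are irrelevant. -/
structure GroupLabelling (Γ : Type*) {α β : Type*} (G : Graph α β) where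
  tail : β → α
  head : β → α
  isLink : ∀ e ∈ E(G), G.IsLink e (tail e) (head e)
  label : β → Γ

namespace GroupLabelling

variable {Γ : Type*} [Group Γ] {α β : Type*} {G : Graph α β}

/-- `φ.HasGain x w y g`: the walk `w` from `x` to `y` can be traversed so that the product of its
labels, inverted at edges traversed backward, is `g`. (The direction in which `w` traverses an
edge is determined by `w`, except for a loop, which may be traversed either way.) -/
inductive HasGain (φ : GroupLabelling Γ G) : α → List (β × α) → α → Γ → Prop
  | nil {x : α} (hx : x ∈ V(G)) : HasGain φ x [] x 1
  | forward {e : β} {x y z : α} {w : List (β × α)} {g : Γ} (he : e ∈ E(G))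
      (hx : φ.tail e = x) (hy : φ.head e = y) (hw : HasGain φ y w z g) :
      HasGain φ x ((e, y) :: w) z (φ.label e * g)
  | backward {e : β} {x y z : α} {w : List (β × α)} {g : Γ} (he : e ∈ E(G))
      (hx : φ.head e = x) (hy : φ.tail e = y) (hw : HasGain φ y w z g) :
      HasGain φ x ((e, y) :: w) z ((φ.label e)⁻¹ * g)

/-- The cycles around which some simple closed walk has gain `1`. -/
def balancedCycles (φ : GroupLabelling Γ G) : Set (Set β) :=
  {C | ∃ x w, G.IsSimpleClosedWalk x w ∧ Graph.walkEdges w = C ∧ φ.HasGain x w x 1}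

end GroupLabelling

/-- The conventions for contracting an unbalanced loop: not allowed, as in the lift matroid, or
as in the frame matroid. -/
inductive LoopContraction
  | forbidden
  | lift
  | frame

namespace BiasedGraph

variable {α β : Type*}

/-- `Ω` is the biased graph of some `Γ`-labelling of its underlying graph. -/
def IsLabellable (Γ : Type*) [Group Γ] (Ω : BiasedGraph α β) : Prop :=
  ∃ φ : GroupLabelling Γ Ω.graph, φ.balancedCycles = Ω.balanced

/-- `Ω'` is obtained from `Ω` by deleting `e`. -/
def IsDeletion (Ω : BiasedGraph α β) (e : β) (Ω' : BiasedGraph α β) : Prop :=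
  Ω'.graph = Ω.graph.deleteEdges {e} ∧ Ω'.balanced = {C ∈ Ω.balanced | e ∉ C}

/-- `Ω'` is obtained from `Ω` by contracting the edge `e` with ends `x` and `y`
(to be used when `x ≠ y`). -/
def IsLinkContraction (Ω : BiasedGraph α β) (e : β) (x y : α) (Ω' : BiasedGraph α β) : Prop :=
  Ω'.graph = Ω.graph.contractLink e x y ∧
  Ω'.balanced = {C | Ω'.graph.IsCycle C ∧ (C ∈ Ω.balanced ∨ insert e C ∈ Ω.balanced)}

/-- `Ω'` is obtained from `Ω` by contracting, as in the lift matroid, the unbalanced loop `e`: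
delete `e` and declare every cycle balanced. -/
def IsLiftLoopContraction (Ω : BiasedGraph α β) (e : β) (Ω' : BiasedGraph α β) : Prop :=
  Ω'.graph = Ω.graph.deleteEdges {e} ∧ Ω'.balanced = {C | Ω'.graph.IsCycle C}

/-- `Ω'` is obtained from `Ω` by contracting, as in the frame matroid, the unbalanced loop `e`
at `v`: delete `e`, turn every edge joining `v` to another vertex `x` into an unbalanced loop
at `x`, and make every other loop at `v` balanced. -/
def IsFrameLoopContraction (Ω : BiasedGraph α β) (e : β) (v : α) (Ω' : BiasedGraph α β) : Prop :=
  V(Ω'.graph) = V(Ω.graph) ∧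
  (∀ f x y, Ω'.graph.IsLink f x y ↔ f ≠ e ∧
    ((Ω.graph.IsLink f x y ∧ x ≠ v ∧ y ≠ v) ∨
      (Ω.graph.IsLink f v x ∧ x ≠ v ∧ x = y) ∨
      (Ω.graph.IsLoopAt f v ∧ x = v ∧ y = v))) ∧
  Ω'.balanced = {C | Ω'.graph.IsCycle C ∧
    (C ∈ Ω.balanced ∨ ∃ f, Ω.graph.IsLoopAt f v ∧ C = {f})}

/-- `Ω'` is obtained from `Ω` by deleting or contracting one edge, where `κ` is the convention for
the contraction of unbalanced loops. -/
inductive MinorStep (κ : LoopContraction) (Ω Ω' : BiasedGraph α β) : Prop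
  | delete (e : β) (he : e ∈ E(Ω.graph)) (h : Ω.IsDeletion e Ω')
  | contractBalancedLoop (e : β) (he : {e} ∈ Ω.balanced) (h : Ω.IsDeletion e Ω')
  | contractLink (e : β) (x y : α) (he : Ω.graph.IsLink e x y) (hxy : x ≠ y)
      (h : Ω.IsLinkContraction e x y Ω')
  | liftContract (hκ : κ = .lift) (e : β) (v : α) (he : Ω.graph.IsLoopAt e v)
      (hu : {e} ∉ Ω.balanced) (h : Ω.IsLiftLoopContraction e Ω')
  | frameContract (hκ : κ = .frame) (e : β) (v : α) (he : Ω.graph.IsLoopAt e v)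
      (hu : {e} ∉ Ω.balanced) (h : Ω.IsFrameLoopContraction e v Ω')

/-- `Ω'` is a minor of `Ω`: it is formed by a finite sequence of deletions and contractions. -/
def IsMinor (κ : LoopContraction) (Ω' Ω : BiasedGraph α β) : Prop :=
  Relation.ReflTransGen (MinorStep κ) Ω Ω'

/-- Isomorphism of biased graphs. -/
def IsIsomorphic (Ω Ω' : BiasedGraph α β) : Prop :=
  ∃ (f : α → α) (g : β → β),
    Set.BijOn f V(Ω.graph) V(Ω'.graph) ∧ Set.BijOn g E(Ω.graph) E(Ω'.graph) ∧
    (∀ e ∈ E(Ω.graph), ∀ x ∈ V(Ω.graph), ∀ y ∈ V(Ω.graph),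
      Ω.graph.IsLink e x y ↔ Ω'.graph.IsLink (g e) (f x) (f y)) ∧
    ∀ C ⊆ E(Ω.graph), C ∈ Ω.balanced ↔ g '' C ∈ Ω'.balanced

/-- `Ω'` is dominated by `Ω`: it is isomorphic to a minor of `Ω`. -/
def IsDominated (κ : LoopContraction) (Ω' Ω : BiasedGraph α β) : Prop :=
  ∃ Ω'' : BiasedGraph α β, IsMinor κ Ω'' Ω ∧ Ω'.IsIsomorphic Ω''

end BiasedGraph

/-!
If `Γ` is finite, a labelled graph on `t` vertices is, up to isomorphism, a multiset on the finite
set of triples (tail, head, label), and inclusion of multisets is domination by deletions. By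
Dickson's lemma inclusion is a well-quasi-order, so antichains are finite.

If `Γ` is infinite, thicken the sides of a triangle on three of the `t` vertices to parallel classes
and label them so that the balanced cycles are `2 n` triangles arranged in a ring, consecutive ones
sharing one edge. There are no loops, so a minor that keeps all `t` vertices arises by deletions
alone. A minor isomorphic to another such graph therefore gives an injection of one ring of
triangles into another that preserves adjacency, and such an injection is onto.
-/

section Walk

open Graph

variable {α β : Type*} {G : Graph α β} {x y : α} {w : List (β × α)}

@[simp]
lemma walkEdges_nil : walkEdges ([] : List (β × α)) = ∅ := by
  simp [walkEdges]

@[simp]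
lemma walkEdges_cons (s : β × α) (w : List (β × α)) :
    walkEdges (s :: w) = insert s.1 (walkEdges w) := by
  ext e
  simp [walkEdges]

lemma walkEdges_subset_edgeSet (h : G.IsWalk x w y) : walkEdges w ⊆ E(G) := by
  induction h with
  | nil _ => simp
  | cons h _ ih => simpa [Set.insert_subset_iff] using ⟨h.edge_mem, ih⟩

lemma isCycle_subset_edgeSet {C : Set β} (h : G.IsCycle C) : C ⊆ E(G) := by
  obtain ⟨x, w, hw, rfl⟩ := h
  exact walkEdges_subset_edgeSet hw.1

lemma exists_isLink_of_mem_walk (h : G.IsWalk x w y) {z : α} (hz : z ∈ w.map Prod.snd) :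
    ∃ e u, G.IsLink e u z := by
  induction h with
  | nil _ => simp at hz
  | cons h _ ih =>
    rcases List.mem_cons.1 hz with rfl | hz
    · exact ⟨_, _, h⟩
    · exact ih hz

lemma end_mem_walk (h : G.IsWalk x w y) (hw : w ≠ []) : y ∈ w.map Prod.snd := by
  induction h with
  | nil _ => exact (hw rfl).elim
  | @cons _ _ _ _ w _ hyz ih =>
    rcases w with - | ⟨s, w⟩
    · cases hyz
      simp
    · exact List.mem_cons_of_mem _ (ih (by simp))

lemma exists_mem_walkInterior (h : G.IsPath x w y) (hw : (walkEdges w).Nontrivial) :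
    ∃ z ∈ walkInterior w, z ≠ x ∧ z ≠ y := by
  obtain ⟨hwalk, hnodup⟩ := h
  rcases w with - | ⟨⟨e, z⟩, - | ⟨s, w⟩⟩
  · simp at hw
  · simp at hw
  · obtain - | ⟨-, hzy⟩ := hwalk
    have hy := end_mem_walk hzy (List.cons_ne_nil s w)
    refine ⟨z, by simp [walkInterior], ?_, ?_⟩
    · rintro rfl
      simp at hnodup
    · rintro rfl
      exact (List.nodup_cons.1 (List.nodup_cons.1 hnodup).2).1 hy

lemma isWalk_deleteEdges_iff {D : Set β} :
    (G.deleteEdges D).IsWalk x w y ↔ G.IsWalk x w y ∧ Disjoint (walkEdges w) D := by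
  constructor
  · intro h
    induction h with
    | nil hx => exact ⟨.nil hx, by simp⟩
    | cons h _ ih => exact ⟨.cons h.1 ih.1, by simpa using ⟨h.2, ih.2⟩⟩
  · rintro ⟨h, hD⟩
    induction h with
    | nil hx => exact .nil hx
    | cons h _ ih =>
      rw [walkEdges_cons, Set.disjoint_insert_left] at hD
      exact .cons ⟨h, hD.1⟩ (ih hD.2)

lemma isTheta_of_deleteEdges {A B C D : Set β} (h : (G.deleteEdges D).IsTheta A B C) :
    G.IsTheta A B C := by
  obtain ⟨x, y, p, q, r, hxy, hp, hq, hr, h⟩ := h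
  exact ⟨x, y, p, q, r, hxy, ⟨(isWalk_deleteEdges_iff.1 hp.1).1, hp.2⟩,
    ⟨(isWalk_deleteEdges_iff.1 hq.1).1, hq.2⟩, ⟨(isWalk_deleteEdges_iff.1 hr.1).1, hr.2⟩, h⟩

lemma isCycle_deleteEdges {C D : Set β} (h : G.IsCycle C) (hD : Disjoint C D) :
    (G.deleteEdges D).IsCycle C := by
  obtain ⟨x, w, ⟨hw, h⟩, rfl⟩ := h
  exact ⟨x, w, ⟨isWalk_deleteEdges_iff.2 ⟨hw, hD⟩, h⟩, rfl⟩

end Walk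

namespace GroupLabelling

open Graph

variable {Γ : Type*} {α β α' β' : Type*} {G : Graph α β} {H : Graph α' β'}
  {φ : GroupLabelling Γ G} {ψ : GroupLabelling Γ H} {f : α → α'} {g : β → β'}

lemma HasGain.isWalk [Group Γ] {x y : α} {w : List (β × α)} {a : Γ} (h : φ.HasGain x w y a) :
    G.IsWalk x w y := by
  induction h with
  | nil hx => exact .nil hx
  | forward he hx hy _ ih => exact .cons (hx ▸ hy ▸ φ.isLink _ he) ih
  | backward he hx hy _ ih => exact .cons (hx ▸ hy ▸ (φ.isLink _ he).symm) ih

/-- Embeddings of one labelled graph into another, given by a map `f` on vertices and a map `g` on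
edges that preserve orientations and labels. As in `BiasedGraph.IsIsomorphic`, only the values on
the vertices and edges of the first graph matter. -/
structure IsEmbedding (φ : GroupLabelling Γ G) (ψ : GroupLabelling Γ H) (f : α → α')
    (g : β → β') : Prop where
  mapsTo_vertexSet : Set.MapsTo f V(G) V(H)
  injOn_vertexSet : Set.InjOn f V(G)
  mapsTo_edgeSet : Set.MapsTo g E(G) E(H)
  injOn_edgeSet : Set.InjOn g E(G)
  tail_eq : ∀ e ∈ E(G), ψ.tail (g e) = f (φ.tail e)
  head_eq : ∀ e ∈ E(G), ψ.head (g e) = f (φ.head e)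
  label_eq : ∀ e ∈ E(G), ψ.label (g e) = φ.label e

lemma exists_isEmbedding {ι : Type*} {ν : α → ι} {ν' : α' → ι} (hν : Set.BijOn ν V(G) Set.univ)
    (hν' : Set.BijOn ν' V(H) Set.univ) (hg : Set.InjOn g E(G))
    (hgE : Set.MapsTo g E(G) E(H))
    (htail : ∀ e ∈ E(G), ν' (ψ.tail (g e)) = ν (φ.tail e))
    (hhead : ∀ e ∈ E(G), ν' (ψ.head (g e)) = ν (φ.head e))
    (hlabel : ∀ e ∈ E(G), ψ.label (g e) = φ.label e) :
    ∃ f, φ.IsEmbedding ψ f g ∧ Set.SurjOn f V(G) V(H) := by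
  choose f hfV hf using fun v => hν'.surjOn (Set.mem_univ (ν v))
  have heq {u : α'} {v : α} (hu : u ∈ V(H)) (huv : ν' u = ν v) : u = f v :=
    hν'.injOn hu (hfV v) (huv.trans (hf v).symm)
  refine ⟨f, ⟨fun v _ => hfV v, fun x hx y hy hxy => hν.injOn hx hy ?_, hgE, hg, ?_, ?_, hlabel⟩,
    fun u hu => ?_⟩
  · rw [← hf x, ← hf y, hxy]
  · exact fun e he => heq (ψ.isLink _ (hgE he)).left_mem (htail e he)
  · exact fun e he => heq (ψ.isLink _ (hgE he)).right_mem (hhead e he)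
  · obtain ⟨v, hv, huv⟩ := hν.surjOn (Set.mem_univ (ν' u))
    exact ⟨v, hv, (heq hu huv.symm).symm⟩

namespace IsEmbedding

lemma isLink_iff (h : φ.IsEmbedding ψ f g) {e : β} {x y : α} (he : e ∈ E(G)) (hx : x ∈ V(G))
    (hy : y ∈ V(G)) : G.IsLink e x y ↔ H.IsLink (g e) (f x) (f y) := by
  have hG := φ.isLink e he
  have hH := ψ.isLink _ (h.mapsTo_edgeSet he)
  rw [h.tail_eq e he, h.head_eq e he] at hH
  rw [hG.isLink_iff, hH.isLink_iff, h.injOn_vertexSet.eq_iff hG.left_mem hx,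
    h.injOn_vertexSet.eq_iff hG.left_mem hy, h.injOn_vertexSet.eq_iff hG.right_mem hx,
    h.injOn_vertexSet.eq_iff hG.right_mem hy]

variable [Group Γ]

lemma hasGain_map (h : φ.IsEmbedding ψ f g) {x y : α} {w : List (β × α)} {a : Γ}
    (hw : φ.HasGain x w y a) : ψ.HasGain (f x) (w.map (Prod.map g f)) (f y) a := by
  induction hw with
  | nil hx => exact .nil (h.mapsTo_vertexSet hx)
  | forward he hx hy _ ih =>
    subst hx hy
    rw [← h.label_eq _ he]
    exact .forward (h.mapsTo_edgeSet he) (h.tail_eq _ he) (h.head_eq _ he) ih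
  | backward he hx hy _ ih =>
    subst hx hy
    rw [← h.label_eq _ he]
    exact .backward (h.mapsTo_edgeSet he) (h.head_eq _ he) (h.tail_eq _ he) ih

lemma exists_hasGain_of_map (h : φ.IsEmbedding ψ f g) {x : α} {x' y' : α'} {w' : List (β' × α')}
    {a : Γ} (hw' : ψ.HasGain x' w' y' a) (hE : walkEdges w' ⊆ g '' E(G)) (hx : x ∈ V(G))
    (hxx' : f x = x') :
    ∃ w y, φ.HasGain x w y a ∧ w' = w.map (Prod.map g f) ∧ f y = y' := by
  induction hw' generalizing x with
  | nil _ => exact ⟨[], x, .nil hx, rfl, hxx'⟩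
  | forward _ htail hhead _ ih =>
    rw [walkEdges_cons, Set.insert_subset_iff] at hE
    obtain ⟨⟨e, he, rfl⟩, hE⟩ := hE
    have hlink := φ.isLink e he
    rw [h.tail_eq e he, ← hxx'] at htail
    rw [h.head_eq e he] at hhead
    obtain ⟨w, z, hw, rfl, hz⟩ := ih hE hlink.right_mem hhead
    refine ⟨(e, φ.head e) :: w, z, ?_, by simp [hhead], hz⟩
    rw [h.label_eq e he]
    exact .forward he (h.injOn_vertexSet hlink.left_mem hx htail) rfl hw
  | backward _ hhead htail _ ih =>
    rw [walkEdges_cons, Set.insert_subset_iff] at hE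
    obtain ⟨⟨e, he, rfl⟩, hE⟩ := hE
    have hlink := φ.isLink e he
    rw [h.head_eq e he, ← hxx'] at hhead
    rw [h.tail_eq e he] at htail
    obtain ⟨w, z, hw, rfl, hz⟩ := ih hE hlink.left_mem htail
    refine ⟨(e, φ.tail e) :: w, z, ?_, by simp [htail], hz⟩
    rw [h.label_eq e he]
    exact .backward he (h.injOn_vertexSet hlink.right_mem hx hhead) rfl hw

lemma isSimpleClosedWalk_map_iff (h : φ.IsEmbedding ψ f g) {x : α} {w : List (β × α)} {a : Γ}
    (hw : φ.HasGain x w x a) :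
    H.IsSimpleClosedWalk (f x) (w.map (Prod.map g f)) ↔ G.IsSimpleClosedWalk x w := by
  have hsnd : (w.map (Prod.map g f)).map Prod.snd = (w.map Prod.snd).map f := by simp
  have hfst : (w.map (Prod.map g f)).map Prod.fst = (w.map Prod.fst).map g := by simp
  have hV : ∀ v ∈ w.map Prod.snd, v ∈ V(G) := fun v hv =>
    let ⟨_, _, huv⟩ := exists_isLink_of_mem_walk hw.isWalk hv
    huv.right_mem
  have hE : ∀ e ∈ w.map Prod.fst, e ∈ E(G) := walkEdges_subset_edgeSet hw.isWalk
  rw [IsSimpleClosedWalk, IsSimpleClosedWalk, hsnd, hfst]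
  refine and_congr (iff_of_true (h.hasGain_map hw).isWalk hw.isWalk) <|
    and_congr (by simp) <| and_congr ⟨List.Nodup.of_map _, fun hn => hn.map_on ?_⟩
      ⟨List.Nodup.of_map _, fun hn => hn.map_on ?_⟩
  · exact fun u hu v hv => h.injOn_vertexSet (hV u hu) (hV v hv)
  · exact fun e he e' he' => h.injOn_edgeSet (hE e he) (hE e' he')

lemma exists_eq_of_hasGain (h : φ.IsEmbedding ψ f g) {x' y' : α'} {w' : List (β' × α')} {a : Γ}
    (hw' : ψ.HasGain x' w' y' a) (hne : w' ≠ []) (hE : walkEdges w' ⊆ g '' E(G)) :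
    ∃ x ∈ V(G), f x = x' := by
  cases hw' with
  | nil _ => exact (hne rfl).elim
  | forward _ htail _ _ =>
    obtain ⟨⟨e, he, rfl⟩, -⟩ := Set.insert_subset_iff.1 (walkEdges_cons _ _ ▸ hE)
    exact ⟨φ.tail e, (φ.isLink e he).left_mem, h.tail_eq e he ▸ htail⟩
  | backward _ hhead _ _ =>
    obtain ⟨⟨e, he, rfl⟩, -⟩ := Set.insert_subset_iff.1 (walkEdges_cons _ _ ▸ hE)
    exact ⟨φ.head e, (φ.isLink e he).right_mem, h.head_eq e he ▸ hhead⟩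

lemma image_mem_balancedCycles_iff (h : φ.IsEmbedding ψ f g) {C : Set β} (hC : C ⊆ E(G)) :
    g '' C ∈ ψ.balancedCycles ↔ C ∈ φ.balancedCycles := by
  have himage (w : List (β × α)) : walkEdges (w.map (Prod.map g f)) = g '' walkEdges w := by
    ext e
    simp [walkEdges]
  constructor
  · rintro ⟨x', w', hcl, hw'C, hgain⟩
    have hE : walkEdges w' ⊆ g '' E(G) := hw'C ▸ Set.image_mono hC
    obtain ⟨x, hx, rfl⟩ := h.exists_eq_of_hasGain hgain hcl.2.1 hE
    obtain ⟨w, y, hw, rfl, hyx⟩ := h.exists_hasGain_of_map hgain hE hx rfl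
    have hne : w ≠ [] := by simpa using hcl.2.1
    obtain ⟨_, _, hy⟩ := exists_isLink_of_mem_walk hw.isWalk (end_mem_walk hw.isWalk hne)
    obtain rfl : y = x := h.injOn_vertexSet hy.right_mem hx hyx
    refine ⟨y, w, (h.isSimpleClosedWalk_map_iff hw).1 hcl, ?_, hw⟩
    exact (h.injOn_edgeSet.image_eq_image_iff (walkEdges_subset_edgeSet hw.isWalk) hC).1
      ((himage w).symm.trans hw'C)
  · rintro ⟨x, w, hcl, rfl, hgain⟩
    exact ⟨f x, w.map (Prod.map g f), (h.isSimpleClosedWalk_map_iff hgain).2 hcl, himage w,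
      h.hasGain_map hgain⟩

end IsEmbedding

end GroupLabelling

namespace BiasedGraph

variable {α β : Type*}

/-- Deletion of a set of edges from a biased graph. -/
def deleteEdges (Ω : BiasedGraph α β) (D : Set β) : BiasedGraph α β where
  graph := Ω.graph.deleteEdges D
  finite_vertexSet := Ω.finite_vertexSet
  finite_edgeSet := Ω.finite_edgeSet.subset Set.sdiff_subset
  balanced := {C ∈ Ω.balanced | Disjoint C D}
  isCycle_of_balanced C hC := isCycle_deleteEdges (Ω.isCycle_of_balanced C hC.1) hC.2
  theta A B C h hAB hBC :=
    ⟨Ω.theta A B C (isTheta_of_deleteEdges h) hAB.1 hBC.1,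
      (hAB.2.mono_left Set.subset_union_left).union_left (hBC.2.mono_left Set.subset_union_right)⟩

lemma deleteEdges_isMinor (κ : LoopContraction) (Ω : BiasedGraph α β) {D : Set β}
    (hD : D ⊆ E(Ω.graph)) : IsMinor κ (Ω.deleteEdges D) Ω := by
  have hfin := Ω.finite_edgeSet.subset hD
  induction D, hfin using Set.Finite.induction_on with
  | empty =>
    have hΩ : Ω.deleteEdges ∅ = Ω := by
      cases Ω
      simp [deleteEdges]
    rw [hΩ]
    exact Relation.ReflTransGen.refl
  | @insert e D he _ ih =>
    refine (ih ((Set.subset_insert _ _).trans hD)).tail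
      (.delete e ⟨hD (Set.mem_insert _ _), he⟩ ⟨?_, ?_⟩)
    · simp only [deleteEdges, Graph.deleteEdges_deleteEdges, Set.union_singleton]
    · ext C
      simp only [deleteEdges, Set.disjoint_insert_right, Set.mem_ofPred_eq]
      tauto

variable {Γ : Type*} [Group Γ] {Ω Ω' : BiasedGraph α β} {φ : GroupLabelling Γ Ω.graph}
  {φ' : GroupLabelling Γ Ω'.graph} {f : α → α} {g : β → β}

lemma isDominated_of_isEmbedding (κ : LoopContraction) (hφ : φ.balancedCycles = Ω.balanced)
    (hφ' : φ'.balancedCycles = Ω'.balanced) (h : φ.IsEmbedding φ' f g)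
    (hf : Set.SurjOn f V(Ω.graph) V(Ω'.graph)) : Ω.IsDominated κ Ω' := by
  set D : Set β := E(Ω'.graph) \ g '' E(Ω.graph) with hD
  have hdisj {C : Set β} (hC : C ⊆ E(Ω.graph)) : Disjoint (g '' C) D :=
    Set.disjoint_sdiff_right.mono_left (Set.image_mono hC)
  have hedge : E((Ω'.deleteEdges D).graph) = g '' E(Ω.graph) := by
    simp [deleteEdges, hD, Set.inter_eq_right.2 h.mapsTo_edgeSet.image_subset]
  refine ⟨Ω'.deleteEdges D, Ω'.deleteEdges_isMinor κ Set.sdiff_subset, f, g,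
    ⟨h.mapsTo_vertexSet, h.injOn_vertexSet, hf⟩, hedge ▸ h.injOn_edgeSet.bijOn_image, ?_, ?_⟩
  · intro e he x hx y hy
    have heD : g e ∉ D := fun hmem => hmem.2 ⟨e, he, rfl⟩
    exact (h.isLink_iff he hx hy).trans (and_iff_left heD).symm
  · intro C hC
    rw [← hφ, ← h.image_mem_balancedCycles_iff hC, hφ']
    exact (and_iff_left (hdisj hC)).symm

end BiasedGraph

section Dickson

variable {β K : Type*}

lemma exists_injOn_of_ncard_fiber_le {T T' : Set β} (hT : T.Finite) (hT' : T'.Finite)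
    {c c' : β → K} (h : ∀ k, {e ∈ T | c e = k}.ncard ≤ {e ∈ T' | c' e = k}.ncard) :
    ∃ g : β → β, Set.InjOn g T ∧ Set.MapsTo g T T' ∧ ∀ e ∈ T, c' (g e) = c e := by
  rcases isEmpty_or_nonempty β with hβ | hβ
  · exact ⟨id, hβ.elim, hβ.elim, hβ.elim⟩
  have hfiber (k : K) : ∃ g : β → β, Set.MapsTo g {e ∈ T | c e = k} {e ∈ T' | c' e = k} ∧
      Set.InjOn g {e ∈ T | c e = k} := by
    have hk : {e ∈ T | c e = k}.Finite := hT.subset (Set.sep_subset _ _)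
    have hk' : {e ∈ T' | c' e = k}.Finite := hT'.subset (Set.sep_subset _ _)
    refine hk.exists_injOn_of_encard_le (t := {e ∈ T' | c' e = k}) ?_
    rw [← hk.cast_ncard_eq, ← hk'.cast_ncard_eq]
    exact_mod_cast h k
  choose g hg hginj using hfiber
  have hcolour (e) (he : e ∈ T) : c' (g (c e) e) = c e := (hg (c e) ⟨he, rfl⟩).2
  refine ⟨fun e => g (c e) e, fun x hx y hy hxy => ?_, fun e he => (hg (c e) ⟨he, rfl⟩).1, hcolour⟩
  have hc : c x = c y := by
    rw [← hcolour x hx, ← hcolour y hy]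
    exact congrArg c' hxy
  exact hginj (c x) ⟨hx, rfl⟩ ⟨hy, hc.symm⟩ (by simpa only [hc] using hxy)

lemma exists_lt_exists_injOn_colouring [Finite K] {T : ℕ → Set β} (hT : ∀ n, (T n).Finite)
    (c : ℕ → β → K) :
    ∃ m n, m < n ∧ ∃ g : β → β, Set.InjOn g (T m) ∧ Set.MapsTo g (T m) (T n) ∧
      ∀ e ∈ T m, c n (g e) = c m e := by
  obtain ⟨m, n, hmn, hle⟩ := wellQuasiOrdered_le (α := K → ℕ) fun n k => {e ∈ T n | c n e = k}.ncard
  exact ⟨m, n, hmn, exists_injOn_of_ncard_fiber_le (hT m) (hT n) hle⟩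

end Dickson

theorem BiasedGraph.partiallyWellOrderedOn_isLabellable (Γ α β : Type*) [Group Γ] [Finite Γ]
    (κ : LoopContraction) (t : ℕ) [NeZero t] :
    {Ω : BiasedGraph α β | V(Ω.graph).ncard = t ∧ Ω.IsLabellable Γ}.PartiallyWellOrderedOn
      (IsDominated κ) := by
  rw [Set.partiallyWellOrderedOn_iff_exists_lt]
  intro Ω hΩ
  have hcard (n) : V((Ω n).graph).encard = (Set.univ : Set (Fin t)).encard := by
    rw [← (Ω n).finite_vertexSet.cast_ncard_eq, (hΩ n).1]
    simp
  have hindex (n) := (Ω n).finite_vertexSet.exists_bijOn_of_encard_eq (hcard n)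
  choose! ν hν using hindex
  choose φ hφ using fun n => (hΩ n).2
  obtain ⟨m, n, hmn, g, hg, hgE, hcolour⟩ :=
    exists_lt_exists_injOn_colouring (fun n => (Ω n).finite_edgeSet) fun n e =>
      (ν n ((φ n).tail e), ν n ((φ n).head e), (φ n).label e)
  simp only [Prod.mk.injEq] at hcolour
  obtain ⟨f, hf, hsurj⟩ := GroupLabelling.exists_isEmbedding (hν m) (hν n) hg hgE
    (fun e he => (hcolour e he).1) (fun e he => (hcolour e he).2.1) fun e he => (hcolour e he).2.2
  exact ⟨m, n, hmn, isDominated_of_isEmbedding κ (hφ m) (hφ n) hf hsurj⟩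

section Minor

variable {α β : Type*}

lemma ncard_vertexSet_contractLink_lt {G : Graph α β} (hG : V(G).Finite) {e : β} {x y : α}
    (h : G.IsLink e x y) (hxy : x ≠ y) : V(G.contractLink e x y).ncard < V(G).ncard := by
  refine Set.ncard_lt_ncard (Set.ssubset_iff_exists.2 ⟨?_, y, h.right_mem, ?_⟩) hG
  · rintro _ ⟨v, hv, rfl⟩
    dsimp only
    split_ifs
    · exact h.left_mem
    · exact hv
  · rintro ⟨v, -, hvy⟩
    dsimp only at hvy
    split_ifs at hvy with hv
    · exact hxy hvy
    · exact hv hvy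

namespace BiasedGraph

variable {κ : LoopContraction} {Ω Ω' : BiasedGraph α β}

lemma MinorStep.ncard_vertexSet_le (h : Ω.MinorStep κ Ω') :
    V(Ω'.graph).ncard ≤ V(Ω.graph).ncard := by
  rcases h with ⟨e, -, h⟩ | ⟨e, -, h⟩ | ⟨e, x, y, he, hxy, h⟩ | ⟨-, e, -, -, -, h⟩ |
    ⟨-, e, x, -, -, h⟩
  · rw [h.1, Graph.vertexSet_deleteEdges]
  · rw [h.1, Graph.vertexSet_deleteEdges]
  · rw [h.1]
    exact (ncard_vertexSet_contractLink_lt Ω.finite_vertexSet he hxy).le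
  · rw [h.1, Graph.vertexSet_deleteEdges]
  · rw [h.1]

lemma MinorStep.exists_isDeletion (h : Ω.MinorStep κ Ω')
    (hloop : ∀ e x, ¬ Ω.graph.IsLoopAt e x) (hcard : V(Ω'.graph).ncard = V(Ω.graph).ncard) :
    ∃ e, Ω.IsDeletion e Ω' := by
  rcases h with ⟨e, -, h⟩ | ⟨e, -, h⟩ | ⟨e, x, y, he, hxy, h⟩ | ⟨-, e, x, he, -, -⟩ |
    ⟨-, e, x, he, -, -⟩
  · exact ⟨e, h⟩
  · exact ⟨e, h⟩
  · exact ((h.1 ▸ ncard_vertexSet_contractLink_lt Ω.finite_vertexSet he hxy).ne hcard).elim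
  · exact (hloop e x he).elim
  · exact (hloop e x he).elim

lemma IsMinor.ncard_vertexSet_le (h : IsMinor κ Ω' Ω) :
    V(Ω'.graph).ncard ≤ V(Ω.graph).ncard := by
  induction h with
  | refl => exact le_rfl
  | tail _ hstep ih => exact hstep.ncard_vertexSet_le.trans ih

lemma IsMinor.balanced_subset (h : IsMinor κ Ω' Ω) (hloop : ∀ e x, ¬ Ω.graph.IsLoopAt e x)
    (hcard : V(Ω'.graph).ncard = V(Ω.graph).ncard) : Ω'.balanced ⊆ Ω.balanced := by
  induction h using Relation.ReflTransGen.head_induction_on with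
  | refl => exact subset_rfl
  | head hstep hminor ih =>
    have hcard' := hstep.ncard_vertexSet_le.antisymm (hcard ▸ IsMinor.ncard_vertexSet_le hminor)
    obtain ⟨e, hgraph, hbalanced⟩ := hstep.exists_isDeletion hloop hcard'
    refine (ih ?_ (hcard.trans hcard'.symm)).trans ?_
    · rintro f x hf
      rw [hgraph] at hf
      exact hloop f x hf.1
    · rw [hbalanced]
      exact Set.sep_subset _ _

lemma IsDominated.exists_injOn_image_mem_balanced (h : IsDominated κ Ω' Ω)
    (hloop : ∀ e x, ¬ Ω.graph.IsLoopAt e x) (hcard : V(Ω'.graph).ncard = V(Ω.graph).ncard) :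
    ∃ g : β → β, Set.InjOn g E(Ω'.graph) ∧ ∀ C ∈ Ω'.balanced, g '' C ∈ Ω.balanced := by
  obtain ⟨Θ, hminor, f, g, hf, hg, -, hbalanced⟩ := h
  refine ⟨g, hg.injOn, fun C hC => hminor.balanced_subset hloop ?_ ?_⟩
  · rw [← hcard, ← hf.image_eq, hf.injOn.ncard_image]
  · exact (hbalanced C (isCycle_subset_edgeSet (Ω'.isCycle_of_balanced C hC))).1 hC

lemma isDominated_refl (κ : LoopContraction) (Ω : BiasedGraph α β) : Ω.IsDominated κ Ω :=
  ⟨Ω, Relation.ReflTransGen.refl, id, id, Set.bijOn_id _, Set.bijOn_id _, by simp, by simp⟩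

end BiasedGraph

end Minor

/-- A triangle whose sides are replaced by any finite numbers of parallel edges, together with
isolated vertices and a labelling by `Γ`. Side `s` consists of the edges from `corner s` to
`corner (s + 1)`, so that all edges are oriented in the same direction around the triangle. -/
structure ThickTriangle (α β Γ : Type*) where
  vertices : Set α
  finite_vertices : vertices.Finite
  corner : Fin 3 ↪ α
  corner_mem : ∀ s, corner s ∈ vertices
  edges : Set β
  finite_edges : edges.Finite
  side : β → Fin 3
  label : β → Γ
  injOn_label : Set.InjOn (fun e => (side e, label e)) edges

namespace ThickTriangle

open Graph

section Graph

variable {α β Γ : Type*} (Δ : ThickTriangle α β Γ)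

/-- The underlying graph of a thick triangle. -/
def graph : Graph α β where
  vertexSet := Δ.vertices
  edgeSet := Δ.edges
  IsLink e x y := e ∈ Δ.edges ∧ s(x, y) = s(Δ.corner (Δ.side e), Δ.corner (Δ.side e + 1))
  isLink_symm _ _ := ⟨fun _ _ h => ⟨h.1, Sym2.eq_swap.trans h.2⟩⟩
  eq_or_eq_of_isLink_of_isLink _ _ _ _ _ h h' :=
    (Sym2.eq_iff.1 (h.2.trans h'.2.symm)).imp And.left And.left
  edge_mem_iff_exists_isLink _ := ⟨fun he => ⟨_, _, he, rfl⟩, fun ⟨_, _, h⟩ => h.1⟩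
  left_mem_of_isLink e x y h := by
    rcases Sym2.eq_iff.1 h.2 with ⟨rfl, -⟩ | ⟨rfl, -⟩ <;> exact Δ.corner_mem _

/-- The labelling of the underlying graph of a thick triangle. -/
def labelling : GroupLabelling Γ Δ.graph where
  tail e := Δ.corner (Δ.side e)
  head e := Δ.corner (Δ.side e + 1)
  isLink _ he := ⟨he, rfl⟩
  label := Δ.label

variable {Δ}

lemma not_isLoopAt {e : β} {x : α} : ¬ Δ.graph.IsLoopAt e x := by
  rintro ⟨-, h⟩
  have hcorner : Δ.corner (Δ.side e) = Δ.corner (Δ.side e + 1) := by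
    rcases Sym2.eq_iff.1 h with ⟨h, h'⟩ | ⟨h, h'⟩
    · exact h.symm.trans h'
    · exact h'.symm.trans h
  simp at hcorner

lemma exists_corner_eq_of_isLink {e : β} {x y : α} (h : Δ.graph.IsLink e x y) :
    ∃ s, Δ.corner s = x := by
  rcases Sym2.eq_iff.1 h.2 with ⟨rfl, -⟩ | ⟨rfl, -⟩ <;> exact ⟨_, rfl⟩

lemma exists_corner_eq_start {x y : α} {w : List (β × α)} (hw : Δ.graph.IsWalk x w y)
    (hne : w ≠ []) : ∃ s, Δ.corner s = x := by
  cases hw with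
  | nil => exact (hne rfl).elim
  | cons h _ => exact exists_corner_eq_of_isLink h

lemma exists_corner_eq_of_mem_walk {x y z : α} {w : List (β × α)} (hw : Δ.graph.IsWalk x w y)
    (hz : z ∈ w.map Prod.snd) : ∃ s, Δ.corner s = z := by
  obtain ⟨_, _, h⟩ := exists_isLink_of_mem_walk hw hz
  exact exists_corner_eq_of_isLink h.symm

lemma length_le_three {x y : α} {w : List (β × α)} (hw : Δ.graph.IsWalk x w y)
    (hnodup : (w.map Prod.snd).Nodup) : w.length ≤ 3 := by
  have hsub : w.map Prod.snd ⊆ List.ofFn Δ.corner := fun _ hz =>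
    (List.mem_ofFn' _ _).2 (exists_corner_eq_of_mem_walk hw hz)
  simpa using (hnodup.subperm hsub).length_le

lemma not_disjoint_walkInterior {x y : α} {p r : List (β × α)} (hxy : x ≠ y)
    (hp : Δ.graph.IsPath x p y) (hr : Δ.graph.IsPath x r y) (hpE : (walkEdges p).Nontrivial)
    (hrE : (walkEdges r).Nontrivial) : ¬ (walkInterior p).Disjoint (walkInterior r) := by
  have hne : p ≠ [] := by
    rintro rfl
    simp at hpE
  obtain ⟨u, hu, hux, huy⟩ := exists_mem_walkInterior hp hpE
  obtain ⟨v, hv, hvx, hvy⟩ := exists_mem_walkInterior hr hrE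
  obtain ⟨s, rfl⟩ := exists_corner_eq_start hp.1 hne
  obtain ⟨s', rfl⟩ := exists_corner_eq_of_mem_walk hp.1 (end_mem_walk hp.1 hne)
  obtain ⟨i, rfl⟩ := exists_corner_eq_of_mem_walk hp.1 (List.mem_of_mem_dropLast hu)
  obtain ⟨j, rfl⟩ := exists_corner_eq_of_mem_walk hr.1 (List.mem_of_mem_dropLast hv)
  simp only [ne_eq, EmbeddingLike.apply_eq_iff_eq] at hxy hux huy hvx hvy
  obtain rfl : i = j := by omega
  exact fun hdisj => hdisj hu hv

end Graph

variable {α β Γ : Type*} [Group Γ] {Δ : ThickTriangle α β Γ}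

variable (Δ) in
/-- The edge `e` can be traversed from the corner `s` to the corner `s'`, and contributes `a` to the
gain of a walk that does so. -/
def Traverses (s : Fin 3) (e : β) (s' : Fin 3) (a : Γ) : Prop :=
  e ∈ Δ.edges ∧ (s = Δ.side e ∧ s' = Δ.side e + 1 ∧ a = Δ.label e ∨
    s = Δ.side e + 1 ∧ s' = Δ.side e ∧ a = (Δ.label e)⁻¹)

namespace Traverses

variable {s s' : Fin 3} {e e' : β} {a : Γ}

lemma symm (h : Δ.Traverses s e s' a) : Δ.Traverses s' e s a⁻¹ := by
  obtain ⟨he, ⟨rfl, rfl, rfl⟩ | ⟨rfl, rfl, rfl⟩⟩ := h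
  · exact ⟨he, .inr ⟨rfl, rfl, rfl⟩⟩
  · exact ⟨he, .inl ⟨rfl, rfl, inv_inv _⟩⟩

lemma ne (h : Δ.Traverses s e s' a) : s ≠ s' := by
  obtain ⟨-, ⟨rfl, rfl, -⟩ | ⟨rfl, rfl, -⟩⟩ := h <;> simp

lemma eq_of_succ (h : Δ.Traverses s e s' a) (hs : s' = s + 1) :
    e ∈ Δ.edges ∧ Δ.side e = s ∧ Δ.label e = a := by
  obtain ⟨he, ⟨rfl, -, rfl⟩ | ⟨hse, hse', -⟩⟩ := h
  · exact ⟨he, rfl, rfl⟩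
  · omega

lemma edge_unique (h : Δ.Traverses s e s' a) (h' : Δ.Traverses s e' s' a) : e = e' := by
  wlog hs : s' = s + 1 generalizing s s' a
  · have hne := h.ne
    exact this h.symm h'.symm (by omega)
  obtain ⟨he, hse, hl⟩ := h.eq_of_succ hs
  obtain ⟨he', hse', hl'⟩ := h'.eq_of_succ hs
  exact Δ.injOn_label he he' (Prod.ext (hse.trans hse'.symm) (hl.trans hl'.symm))

end Traverses

lemma labelling_hasGain_cons_iff {s : Fin 3} {y z : α} {e : β} {w : List (β × α)} {a : Γ} :
    Δ.labelling.HasGain (Δ.corner s) ((e, y) :: w) z a ↔ ∃ s' b c, Δ.corner s' = y ∧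
      Δ.Traverses s e s' b ∧ Δ.labelling.HasGain y w z c ∧ b * c = a := by
  constructor
  · intro h
    cases h with
    | forward he hx hy hw =>
      exact ⟨_, _, _, hy, ⟨he, .inl ⟨(Δ.corner.injective hx).symm, rfl, rfl⟩⟩, hw, rfl⟩
    | backward he hx hy hw =>
      exact ⟨_, _, _, hy, ⟨he, .inr ⟨(Δ.corner.injective hx).symm, rfl, rfl⟩⟩, hw, rfl⟩
  · rintro ⟨s', b, c, rfl, ⟨he, ⟨rfl, rfl, rfl⟩ | ⟨rfl, rfl, rfl⟩⟩, hw, rfl⟩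
    · exact .forward he rfl rfl hw
    · exact .backward he rfl rfl hw

lemma labelling_hasGain_nil_iff {s s' : Fin 3} {a : Γ} :
    Δ.labelling.HasGain (Δ.corner s) [] (Δ.corner s') a ↔ s = s' ∧ a = 1 := by
  constructor
  · intro h
    generalize hx : Δ.corner s = x, hy : Δ.corner s' = y at h
    cases h
    exact ⟨Δ.corner.injective (hx.trans hy.symm), rfl⟩
  · rintro ⟨rfl, rfl⟩
    exact .nil (Δ.corner_mem s)

variable (Δ) in
/-- The edges `e 0`, `e 1` and `e 2` form a triangle of gain `1`. -/
def IsBalancedTriangle (e : Fin 3 → β) : Prop :=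
  (∀ s, e s ∈ Δ.edges ∧ Δ.side (e s) = s) ∧
    Δ.label (e 0) * Δ.label (e 1) * Δ.label (e 2) = 1

variable (Δ) in
/-- The edge sets of the triangles of gain `1`. -/
def balancedTriangles : Set (Set β) := {C | ∃ e, Δ.IsBalancedTriangle e ∧ Set.range e = C}

lemma mem_balancedTriangles {p q r : β} (hp : p ∈ Δ.edges) (hq : q ∈ Δ.edges) (hr : r ∈ Δ.edges)
    (hpq : Δ.side q = Δ.side p + 1) (hqr : Δ.side r = Δ.side q + 1)
    (h : Δ.label p * Δ.label q * Δ.label r = 1) : {p, q, r} ∈ Δ.balancedTriangles := by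
  obtain hs | hs | hs : Δ.side p = 0 ∨ Δ.side p = 1 ∨ Δ.side p = 2 := by omega
  · refine ⟨![p, q, r], ⟨?_, h⟩, ?_⟩
    · simp [Fin.forall_fin_succ, *]
    · ext
      simp
      tauto
  · refine ⟨![r, p, q], ⟨?_, ?_⟩, ?_⟩
    · simp [Fin.forall_fin_succ, *]
    · simpa [mul_assoc] using mul_eq_one_comm.1 h
    · ext
      simp
      tauto
  · refine ⟨![q, r, p], ⟨?_, ?_⟩, ?_⟩
    · simp [Fin.forall_fin_succ, *]
    · exact mul_eq_one_comm.1 (by simpa [mul_assoc] using h)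
    · ext
      simp
      tauto

lemma Traverses.triangle_mem_balancedTriangles {s₁ s₂ s₃ : Fin 3} {e₁ e₂ e₃ : β} {a₁ a₂ a₃ : Γ}
    (h₁ : Δ.Traverses s₁ e₁ s₂ a₁) (h₂ : Δ.Traverses s₂ e₂ s₃ a₂) (h₃ : Δ.Traverses s₃ e₃ s₁ a₃)
    (h : a₁ * a₂ * a₃ = 1) : {e₁, e₂, e₃} ∈ Δ.balancedTriangles := by
  have hne := And.intro h₁.ne (And.intro h₂.ne h₃.ne)
  wlog hs : s₂ = s₁ + 1 generalizing s₁ s₂ s₃ e₁ e₂ e₃ a₁ a₂ a₃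
  · have hset : ({e₁, e₂, e₃} : Set β) = {e₃, e₂, e₁} := by
      rw [Set.insert_comm e₁, Set.pair_comm e₁, Set.insert_comm e₂]
    rw [hset]
    refine this h₃.symm h₂.symm h₁.symm ?_ ⟨h₃.symm.ne, h₂.symm.ne, h₁.symm.ne⟩ (by omega)
    simpa [mul_assoc] using congrArg (·⁻¹) h
  obtain ⟨he₁, hs₁, rfl⟩ := h₁.eq_of_succ hs
  obtain ⟨he₂, hs₂, rfl⟩ := h₂.eq_of_succ (by omega)
  obtain ⟨he₃, hs₃, rfl⟩ := h₃.eq_of_succ (by omega)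
  exact mem_balancedTriangles he₁ he₂ he₃ (by omega) (by omega) h

lemma balancedTriangles_subset_balancedCycles :
    Δ.balancedTriangles ⊆ Δ.labelling.balancedCycles := by
  rintro _ ⟨e, ⟨he, hgain⟩, rfl⟩
  have htraverse (s : Fin 3) : Δ.Traverses s (e s) (s + 1) (Δ.label (e s)) :=
    ⟨(he s).1, .inl ⟨(he s).2.symm, by rw [(he s).2], rfl⟩⟩
  have hinj : e.Injective := Function.LeftInverse.injective fun s => (he s).2
  have hw : Δ.labelling.HasGain (Δ.corner 0)
      [(e 0, Δ.corner 1), (e 1, Δ.corner 2), (e 2, Δ.corner 0)] (Δ.corner 0) 1 := by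
    simp only [labelling_hasGain_cons_iff, labelling_hasGain_nil_iff]
    exact ⟨_, _, _, rfl, htraverse 0, ⟨_, _, _, rfl, htraverse 1,
      ⟨_, _, _, rfl, htraverse 2, ⟨trivial, rfl⟩, rfl⟩, rfl⟩, by simpa [mul_assoc] using hgain⟩
  refine ⟨_, _, ⟨hw.isWalk, by simp, by simp, by simp [hinj.eq_iff]⟩, ?_, hw⟩
  ext
  simp [Fin.exists_fin_succ, eq_comm]

lemma balancedCycles_labelling : Δ.labelling.balancedCycles = Δ.balancedTriangles := by
  refine Set.Subset.antisymm ?_ balancedTriangles_subset_balancedCycles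
  rintro _ ⟨x, w, ⟨hwalk, hne, hV, hE⟩, rfl, hgain⟩
  have hlength := length_le_three hwalk hV
  obtain ⟨s₁, rfl⟩ := exists_corner_eq_start hwalk hne
  obtain - | ⟨⟨e₁, _⟩, w⟩ := w
  · exact (hne rfl).elim
  obtain ⟨s₂, a₁, _, rfl, h₁, hgain₁, hone⟩ := labelling_hasGain_cons_iff.1 hgain
  obtain - | ⟨⟨e₂, _⟩, w⟩ := w
  · obtain ⟨rfl, -⟩ := labelling_hasGain_nil_iff.1 hgain₁
    exact (h₁.ne rfl).elim
  obtain ⟨s₃, a₂, _, rfl, h₂, hgain₂, rfl⟩ := labelling_hasGain_cons_iff.1 hgain₁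
  obtain - | ⟨⟨e₃, _⟩, w⟩ := w
  · obtain ⟨rfl, rfl⟩ := labelling_hasGain_nil_iff.1 hgain₂
    obtain rfl : a₂ = a₁⁻¹ := by rwa [mul_one, mul_eq_one_iff_inv_eq, eq_comm] at hone
    simp [h₁.symm.edge_unique h₂] at hE
  obtain ⟨s₄, a₃, _, rfl, h₃, hgain₃, rfl⟩ := labelling_hasGain_cons_iff.1 hgain₂
  obtain - | ⟨_, w⟩ := w
  · obtain ⟨rfl, rfl⟩ := labelling_hasGain_nil_iff.1 hgain₃
    simpa using h₁.triangle_mem_balancedTriangles h₂ h₃ (by simpa [mul_assoc] using hone)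
  · simp only [List.length_cons] at hlength
    omega

namespace IsBalancedTriangle

variable {e e' : Fin 3 → β}

lemma injective (h : Δ.IsBalancedTriangle e) : e.Injective :=
  Function.LeftInverse.injective fun s => (h.1 s).2

lemma eq_of_forall_ne (h : Δ.IsBalancedTriangle e) (h' : Δ.IsBalancedTriangle e') {s : Fin 3}
    (heq : ∀ u ≠ s, e u = e' u) : e = e' := by
  have hprod := h.2.trans h'.2.symm
  have hlabel : Δ.label (e s) = Δ.label (e' s) := by
    obtain rfl | rfl | rfl : s = 0 ∨ s = 1 ∨ s = 2 := by omega
    · simpa [heq 1, heq 2] using hprod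
    · simpa [heq 0, heq 2] using hprod
    · simpa [heq 0, heq 1] using hprod
  have hs : e s = e' s := Δ.injOn_label (h.1 s).1 (h'.1 s).1
    (Prod.ext ((h.1 s).2.trans (h'.1 s).2.symm) hlabel)
  funext u
  rcases eq_or_ne u s with rfl | hu
  · exact hs
  · exact heq u hu

end IsBalancedTriangle

lemma encard_of_mem_balancedTriangles {T : Set β} (hT : T ∈ Δ.balancedTriangles) :
    T.encard = 3 := by
  obtain ⟨e, he, rfl⟩ := hT
  rw [← Set.image_univ, he.injective.encard_image, Set.encard_univ]
  simp

lemma eq_of_nontrivial_inter {T T' : Set β} (hT : T ∈ Δ.balancedTriangles)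
    (hT' : T' ∈ Δ.balancedTriangles) (h : (T ∩ T').Nontrivial) : T = T' := by
  obtain ⟨e, he, rfl⟩ := hT
  obtain ⟨e', he', rfl⟩ := hT'
  have hmem {b : β} (hb : b ∈ Set.range e ∩ Set.range e') :
      e (Δ.side b) = b ∧ e' (Δ.side b) = b := by
    obtain ⟨⟨s, rfl⟩, s', hs'⟩ := hb
    obtain rfl : s' = s := by rw [← (he.1 s).2, ← hs', (he'.1 s').2]
    exact ⟨by rw [(he.1 s').2], by rw [(he.1 s').2, hs']⟩
  obtain ⟨b, hb, c, hc, hbc⟩ := h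
  have hside : Δ.side b ≠ Δ.side c := fun h => hbc (by rw [← (hmem hb).1, h, (hmem hc).1])
  have hthird : ∀ a b : Fin 3, a ≠ b → ∃ s, ∀ u ≠ s, u = a ∨ u = b := by decide
  obtain ⟨s, hs⟩ := hthird _ _ hside
  rw [he.eq_of_forall_ne he' (s := s)]
  intro u hu
  rcases hs u hu with rfl | rfl
  · exact (hmem hb).1.trans (hmem hb).2.symm
  · exact (hmem hc).1.trans (hmem hc).2.symm

/- Two balanced triangles with two common edges coincide, so in a theta with two balanced cycles the
path common to both is a single edge, and the other two paths meet at the third corner. -/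
lemma not_isTheta {A B C : Set β} (hAB : A ∪ B ∈ Δ.balancedTriangles)
    (hBC : B ∪ C ∈ Δ.balancedTriangles) : ¬ Δ.graph.IsTheta A B C := by
  rintro ⟨x, y, p, q, r, hxy, hp, -, hr, -, -, hpr, rfl, rfl, rfl, hdAB, -, hdAC⟩
  have hpq : walkEdges p ∪ walkEdges q ≠ walkEdges q ∪ walkEdges r := by
    intro heq
    have hsub : walkEdges p ⊆ walkEdges q ∪ walkEdges r := heq ▸ Set.subset_union_left
    have hempty : walkEdges p = ∅ := (hdAB.union_right hdAC).eq_bot_of_le hsub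
    obtain - | ⟨s, p⟩ := p
    · cases hp.1
      exact hxy rfl
    · exact (Set.insert_nonempty _ _).ne_empty (walkEdges_cons s p ▸ hempty)
  have hq : (walkEdges q).encard ≤ 1 := by
    rw [Set.encard_le_one_iff_subsingleton, ← Set.not_nontrivial_iff]
    exact fun h => hpq <| eq_of_nontrivial_inter hAB hBC <|
      h.mono (Set.subset_inter Set.subset_union_right Set.subset_union_left)
  have hnontrivial {D : Set β} (hD : (D ∪ walkEdges q).encard = 3) : D.Nontrivial := by
    rw [← Set.one_lt_encard_iff_nontrivial]
    by_contra! h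
    have := hD ▸ (Set.encard_union_le D (walkEdges q)).trans (add_le_add h hq)
    norm_num at this
  refine not_disjoint_walkInterior hxy hp hr (hnontrivial ?_) (hnontrivial ?_) hpr
  · exact encard_of_mem_balancedTriangles hAB
  · rw [Set.union_comm]
    exact encard_of_mem_balancedTriangles hBC

variable (Δ) in
/-- The biased graph of a thick triangle: its balanced cycles are the triangles of gain `1`. -/
def toBiasedGraph : BiasedGraph α β where
  graph := Δ.graph
  finite_vertexSet := Δ.finite_vertices
  finite_edgeSet := Δ.finite_edges
  balanced := Δ.balancedTriangles
  isCycle_of_balanced _ hC := by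
    obtain ⟨x, w, hw, hwC, -⟩ := balancedTriangles_subset_balancedCycles hC
    exact ⟨x, w, hw, hwC⟩
  theta _ _ _ h hAB hBC := (not_isTheta hAB hBC h).elim

variable (Δ) in
lemma isLabellable_toBiasedGraph : Δ.toBiasedGraph.IsLabellable Γ :=
  ⟨Δ.labelling, balancedCycles_labelling⟩

end ThickTriangle

section OfEmbedding

variable {α β Γ E : Type*} [Finite E] {W : Set α} (hW : W.Finite) (corner : Fin 3 ↪ α)
  (hcorner : ∀ s, corner s ∈ W) (ι : E ↪ β) (side : E → Fin 3) (label : E → Γ)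
  (hinj : Function.Injective fun i => (side i, label i))

/-- The thick triangle with edge set `Set.range ι` whose sides and labels are prescribed on `E`. -/
noncomputable def ThickTriangle.ofEmbedding [One Γ] : ThickTriangle α β Γ where
  vertices := W
  finite_vertices := hW
  corner := corner
  corner_mem := hcorner
  edges := Set.range ι
  finite_edges := Set.finite_range ι
  side := Function.extend ι side 0
  label := Function.extend ι label 1
  injOn_label := by
    rintro _ ⟨i, rfl⟩ _ ⟨j, rfl⟩ h
    simp only [ι.injective.extend_apply] at h
    rw [hinj h]

variable {hW corner hcorner ι side label hinj}

lemma ThickTriangle.isBalancedTriangle_ofEmbedding_iff [Group Γ] {e : Fin 3 → β} :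
    (ThickTriangle.ofEmbedding hW corner hcorner ι side label hinj).IsBalancedTriangle e ↔
      ∃ i : Fin 3 → E, ι ∘ i = e ∧ (∀ s, side (i s) = s) ∧
        label (i 0) * label (i 1) * label (i 2) = 1 := by
  constructor
  · rintro ⟨he, hgain⟩
    choose i hi using fun s => (he s).1
    obtain rfl : ι ∘ i = e := funext hi
    exact ⟨i, rfl, by simpa [ofEmbedding, ι.injective.extend_apply] using he,
      by simpa [ofEmbedding, ι.injective.extend_apply] using hgain⟩
  · rintro ⟨i, rfl, hs, hgain⟩
    simpa [IsBalancedTriangle, ofEmbedding, ι.injective.extend_apply] using ⟨hs, hgain⟩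

end OfEmbedding

lemma exists_injective_mul (Γ ι : Type*) [Group Γ] [Infinite Γ] [Finite ι] :
    ∃ a b : ι → Γ, Function.Injective fun p : ι × ι => a p.1 * b p.2 := by
  obtain ⟨r, hr⟩ := exists_injective_nat ι
  let a : ι → Γ := Infinite.natEmbedding Γ ∘ r
  have ha : a.Injective := (Infinite.natEmbedding Γ).injective.comp hr
  obtain ⟨b, -, hb⟩ := exists_seq_of_forall_finset_exists (fun _ : Γ => True)
    (fun x y => ∀ i j, a i * x ≠ a j * y) fun s _ => by
      obtain ⟨y, hy⟩ :=
        (Set.finite_range fun q : ι × ι × s => (a q.2.1)⁻¹ * (a q.1 * q.2.2)).exists_notMem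
      exact ⟨y, trivial, fun x hx i j h => hy ⟨(i, j, ⟨x, hx⟩), by simp [h]⟩⟩
  refine ⟨a, b ∘ r, fun ⟨i, j⟩ ⟨i', j'⟩ h => ?_⟩
  have hj : r j = r j' := by
    by_contra hne
    rcases lt_or_gt_of_ne hne with hlt | hlt
    · exact hb _ _ hlt i i' h
    · exact hb _ _ hlt i' i h.symm
  obtain rfl := hr hj
  exact congrArg (·, j) (ha (mul_right_cancel h))

section ArcTriangle

variable {I J Γ : Type*} [Group Γ] {p : I → J × J} {a b : J → Γ}

variable (p) in
/-- The triangle made for the arc `i` of the digraph `p`. Its sides are named by the source of the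
arc, by its target, and by the arc itself, so that triangles of arcs with a common source or a
common target share a side. -/
def arcTriangle (i : I) : Fin 3 → J ⊕ J ⊕ I :=
  ![.inl (p i).1, .inr (.inl (p i).2), .inr (.inr i)]

lemma injective_range_arcTriangle : Function.Injective fun i => Set.range (arcTriangle p i) := by
  intro i j h
  have hi : .inr (.inr i) ∈ Set.range (arcTriangle p j) := h.le ⟨2, rfl⟩
  simpa [arcTriangle] using hi

lemma range_arcTriangle_inter_nonempty_iff {i j : I} :
    (Set.range (arcTriangle p i) ∩ Set.range (arcTriangle p j)).Nonempty ↔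
      (p i).1 = (p j).1 ∨ (p i).2 = (p j).2 := by
  constructor
  · rintro ⟨_, ⟨s, rfl⟩, s', h⟩
    fin_cases s <;> fin_cases s' <;> simp_all [arcTriangle]
  · rintro (h | h)
    · exact ⟨_, ⟨0, rfl⟩, 0, congrArg Sum.inl h.symm⟩
    · exact ⟨_, ⟨1, rfl⟩, 1, congrArg (Sum.inr ∘ Sum.inl) h.symm⟩

/-- The side of a triangle `arcTriangle p i` at which an edge stands. -/
def arcSide : J ⊕ J ⊕ I → Fin 3 :=
  Sum.elim 0 (Sum.elim 1 2)

variable (p a b) in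
/-- The labelling of the sides of the triangles `arcTriangle p i` that has the values `a` at
sources and `b` at targets and for which all of these triangles have gain `1`. -/
def arcLabel : J ⊕ J ⊕ I → Γ :=
  Sum.elim a (Sum.elim b fun i => (a (p i).1 * b (p i).2)⁻¹)

lemma injective_arcSide_arcLabel (hab : Function.Injective fun q : J × J => a q.1 * b q.2)
    (hp : p.Injective) :
    Function.Injective fun e => (arcSide e, arcLabel p a b e) := by
  have ha {i j : J} (h : a i = a j) : i = j :=
    congrArg Prod.fst (hab (a₁ := (i, i)) (a₂ := (j, i)) (congrArg (· * b i) h))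
  have hb {i j : J} (h : b i = b j) : i = j :=
    congrArg Prod.snd (hab (a₁ := (i, i)) (a₂ := (i, j)) (congrArg (a i * ·) h))
  have hab' {i j : I} (h : a (p i).1 * b (p i).2 = a (p j).1 * b (p j).2) : i = j := hp (hab h)
  rintro (i | i | i) (j | j | j) h <;>
    simp only [arcSide, arcLabel, Sum.elim_inl, Sum.elim_inr, Prod.mk.injEq, Pi.ofNat_apply,
      inv_inj, true_and, Fin.reduceEq, false_and] at h
  · rw [ha h]
  · rw [hb h]
  · rw [hab' h]

lemma exists_arcTriangle_eq_iff (hab : Function.Injective fun q : J × J => a q.1 * b q.2)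
    {e : Fin 3 → J ⊕ J ⊕ I} :
    (∃ i, arcTriangle p i = e) ↔ (∀ s, arcSide (e s) = s) ∧
      arcLabel p a b (e 0) * arcLabel p a b (e 1) * arcLabel p a b (e 2) = 1 := by
  constructor
  · rintro ⟨i, rfl⟩
    simp [arcTriangle, arcSide, arcLabel, Fin.forall_fin_succ]
  · rintro ⟨hs, h⟩
    have hs₀ := hs 0
    have hs₁ := hs 1
    have hs₂ := hs 2
    rcases h₀ : e 0 with j | j | j <;> rcases h₁ : e 1 with k | k | k <;>
      rcases h₂ : e 2 with i | i | i <;> simp [arcSide, h₀, h₁, h₂] at hs₀ hs₁ hs₂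
    rw [h₀, h₁, h₂] at h
    obtain hjk : (j, k) = p i := hab (mul_inv_eq_one.1 h)
    refine ⟨i, funext fun s => ?_⟩
    fin_cases s <;> simp [arcTriangle, ← hjk, h₀, h₁, h₂]

lemma exists_thickTriangle_arcTriangle [Infinite Γ] [Finite I] [Finite J] {α β : Type*} {W : Set α}
    (hW : W.Finite) (corner : Fin 3 ↪ α) (hcorner : ∀ s, corner s ∈ W) (hp : p.Injective)
    (ι : J ⊕ J ⊕ I ↪ β) :
    ∃ Δ : ThickTriangle α β Γ, Δ.vertices = W ∧ Δ.edges = Set.range ι ∧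
      Δ.balancedTriangles = Set.range fun i => Set.range (ι ∘ arcTriangle p i) := by
  obtain ⟨a, b, hab⟩ := exists_injective_mul Γ J
  refine ⟨.ofEmbedding hW corner hcorner ι arcSide (arcLabel p a b)
    (injective_arcSide_arcLabel hab hp), rfl, rfl, ?_⟩
  ext C
  simp only [ThickTriangle.balancedTriangles, ThickTriangle.isBalancedTriangle_ofEmbedding_iff,
    ← exists_arcTriangle_eq_iff hab]
  constructor
  · rintro ⟨_, ⟨_, rfl, i, rfl⟩, rfl⟩
    exact ⟨i, rfl⟩
  · rintro ⟨i, rfl⟩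
    exact ⟨_, ⟨_, rfl, i, rfl⟩, rfl⟩

end ArcTriangle

section AlternatingArc

variable {m n : ℕ}

lemma two_ne_zero_of_three_le {N : ℕ} (hN : 3 ≤ N) : (2 : ZMod N) ≠ 0 := by
  exact_mod_cast mt (ZMod.natCast_eq_zero_iff 2 N).1 (Nat.not_dvd_of_pos_of_lt two_pos hN)

lemma surjective_of_adjacent {M N : ℕ} [NeZero N] (hM : 3 ≤ M) {σ : ZMod M → ZMod N}
    (hσ : σ.Injective) (hadj : ∀ k, σ (k + 1) = σ k + 1 ∨ σ k = σ (k + 1) + 1) :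
    σ.Surjective := by
  have hsucc (k : ZMod M) : ∃ k', σ k' = σ k + 1 := by
    rcases hadj k with h | h
    · exact ⟨_, h⟩
    refine ⟨k - 1, ?_⟩
    rcases sub_add_cancel k 1 ▸ hadj (k - 1) with h' | h'
    · have heq : k - 1 = k + 1 := hσ (add_right_cancel (h'.symm.trans h))
      exact (two_ne_zero_of_three_le hM (by grind)).elim
    · exact h'
  have hadd (d : ℕ) : ∃ k, σ k = σ 0 + d := by
    induction d with
    | zero => exact ⟨0, by simp⟩
    | succ d ih =>
      obtain ⟨k, hk⟩ := ih
      obtain ⟨k', hk'⟩ := hsucc k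
      exact ⟨k', by rw [hk', hk, Nat.cast_succ, add_assoc]⟩
  intro y
  obtain ⟨k, hk⟩ := hadd (y - σ 0).val
  exact ⟨k, by simpa using hk⟩

/-- The edges of a cycle of length `2 * n`, directed so that every vertex is a source or a sink;
consecutive edges thus have the same source or the same target. -/
def alternatingArc (n : ℕ) (k : ZMod (2 * n)) : ZMod (2 * n) × ZMod (2 * n) :=
  if ZMod.castHom (dvd_mul_right 2 n) (ZMod 2) k = 0 then (k, k + 1) else (k + 1, k)

lemma alternatingArc_injective (hn : 2 ≤ n) : (alternatingArc n).Injective := by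
  have htwo := two_ne_zero_of_three_le (N := 2 * n) (by omega)
  intro k k' h
  simp only [alternatingArc] at h
  grind

lemma alternatingArc_fst_eq_or_snd_eq_iff {k k' : ZMod (2 * n)} :
    (alternatingArc n k).1 = (alternatingArc n k').1 ∨
      (alternatingArc n k).2 = (alternatingArc n k').2 ↔ k = k' ∨ k' = k + 1 ∨ k = k' + 1 := by
  have hparity : ∀ a : ZMod 2, a + 1 = 0 ↔ a ≠ 0 := by decide
  constructor
  · simp only [alternatingArc]
    grind
  · rintro (rfl | rfl | rfl)
    · exact .inl rfl
    · simp only [alternatingArc, map_add, map_one, hparity]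
      grind
    · simp only [alternatingArc, map_add, map_one, hparity]
      grind

lemma eq_of_range_arcTriangle_alternatingArc {β : Type*} [NeZero n] (hm : 2 ≤ m)
    {f : ZMod (2 * m) ⊕ ZMod (2 * m) ⊕ ZMod (2 * m) → β}
    {g : ZMod (2 * n) ⊕ ZMod (2 * n) ⊕ ZMod (2 * n) → β} (hf : f.Injective) (hg : g.Injective)
    (h : ∀ k, ∃ k', Set.range (g ∘ arcTriangle (alternatingArc n) k') =
      Set.range (f ∘ arcTriangle (alternatingArc m) k)) : m = n := by
  simp only [Set.range_comp] at h
  choose σ hσ using h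
  have hinj : σ.Injective := fun k k' hkk' =>
    injective_range_arcTriangle <| hf.image_injective <| by rw [← hσ, ← hσ, hkk']
  have hadj (k) : σ (k + 1) = σ k + 1 ∨ σ k = σ (k + 1) + 1 := by
    have hmeet : (Set.range (arcTriangle (alternatingArc m) k) ∩
        Set.range (arcTriangle (alternatingArc m) (k + 1))).Nonempty :=
      range_arcTriangle_inter_nonempty_iff.2
        (alternatingArc_fst_eq_or_snd_eq_iff.2 (.inr (.inl rfl)))
    rw [← Set.image_nonempty (f := f), Set.image_inter hf, ← hσ, ← hσ, ← Set.image_inter hg,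
      Set.image_nonempty, range_arcTriangle_inter_nonempty_iff, alternatingArc_fst_eq_or_snd_eq_iff]
      at hmeet
    refine hmeet.resolve_left fun heq => two_ne_zero_of_three_le (N := 2 * m) (by omega) ?_
    have hone : (1 : ZMod (2 * m)) = 0 := left_eq_add.1 (hinj heq)
    linear_combination 2 * hone
  have hbij : σ.Bijective := ⟨hinj, surjective_of_adjacent (by omega) hinj hadj⟩
  simpa using Nat.card_eq_of_bijective σ hbij

end AlternatingArc

lemma exists_thickTriangle_alternatingArc (α β Γ : Type*) [Infinite α] [Infinite β] [Group Γ]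
    [Infinite Γ] {t : ℕ} (ht : 3 ≤ t) (n : ℕ) [NeZero n] (hn : 2 ≤ n) :
    ∃ (Δ : ThickTriangle α β Γ) (ι : ZMod (2 * n) ⊕ ZMod (2 * n) ⊕ ZMod (2 * n) ↪ β),
      Δ.vertices.ncard = t ∧ Δ.edges = Set.range ι ∧
      Δ.balancedTriangles =
        Set.range fun k => Set.range (ι ∘ arcTriangle (alternatingArc n) k) := by
  obtain ⟨r, hr⟩ := exists_injective_nat (ZMod (2 * n) ⊕ ZMod (2 * n) ⊕ ZMod (2 * n))
  let v := Infinite.natEmbedding α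
  let ι := (⟨r, hr⟩ : _ ↪ ℕ).trans (Infinite.natEmbedding β)
  obtain ⟨Δ, hV, hE, hbalanced⟩ := exists_thickTriangle_arcTriangle (Γ := Γ)
    ((Set.finite_Iio t).image v) (Fin.valEmbedding.trans v) (fun s => ⟨s, s.2.trans_le ht, rfl⟩)
    (alternatingArc_injective hn) ι
  refine ⟨Δ, ι, ?_, hE, hbalanced⟩
  rw [hV, Set.ncard_image_of_injective _ v.injective]
  simp

theorem exists_infinite_antichain (α β Γ : Type*) [Infinite α] [Infinite β] [Group Γ] [Infinite Γ]
    (κ : LoopContraction) {t : ℕ} (ht : 3 ≤ t) :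
    ∃ S : Set (BiasedGraph α β), S.Infinite ∧ IsAntichain (BiasedGraph.IsDominated κ) S ∧
      ∀ Ω ∈ S, V(Ω.graph).ncard = t ∧ Ω.IsLabellable Γ := by
  choose Δ ι hV hE hbalanced using fun n =>
    exists_thickTriangle_alternatingArc α β Γ ht (n + 2) (Nat.le_add_left 2 n)
  let Ω (n : ℕ) : BiasedGraph α β := (Δ n).toBiasedGraph
  have heq {m n : ℕ} (h : (Ω m).IsDominated κ (Ω n)) : m = n := by
    obtain ⟨g, hg, hgbalanced⟩ := h.exists_injOn_image_mem_balanced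
      (fun _ _ => ThickTriangle.not_isLoopAt) ((hV m).trans (hV n).symm)
    have hgι : (g ∘ ι m).Injective := fun i j hij =>
      (ι m).injective (hg ((hE m).ge ⟨i, rfl⟩) ((hE m).ge ⟨j, rfl⟩) hij)
    refine add_right_cancel (b := 2)
      (eq_of_range_arcTriangle_alternatingArc (Nat.le_add_left 2 m) hgι (ι n).injective fun k => ?_)
    have hk := hgbalanced (Set.range (ι m ∘ arcTriangle (alternatingArc (m + 2)) k))
      ((hbalanced m).ge ⟨k, rfl⟩)
    rw [← Set.range_comp] at hk
    exact (hbalanced n).le hk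
  have hinj : Ω.Injective := fun m n h => heq (h ▸ (Ω m).isDominated_refl κ)
  refine ⟨Set.range Ω, Set.infinite_range_of_injective hinj, ?_, ?_⟩
  · rintro _ ⟨m, rfl⟩ _ ⟨n, rfl⟩ hne h
    exact hne (congrArg Ω (heq h))
  · rintro _ ⟨n, rfl⟩
    exact ⟨hV n, (Δ n).isLabellable_toBiasedGraph⟩

/-- The vertex and edge types are only required to be infinite, so that every finite graph has
an isomorphic copy with its vertices in `α` and its edges in `β`. -/
theorem theorem1p5 {Γ α β : Type*} [Group Γ] [Infinite α] [Infinite β] (κ : LoopContraction)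
    (t : ℕ) (ht : 3 ≤ t) :
    (∃ S : Set (BiasedGraph α β), S.Infinite ∧ IsAntichain (BiasedGraph.IsDominated κ) S ∧
      ∀ Ω ∈ S, V(Ω.graph).ncard = t ∧ Ω.IsLabellable Γ) ↔ Infinite Γ := by
  constructor
  · rintro ⟨S, hS, hanti, hlabellable⟩
    by_contra hΓ
    have : Finite Γ := not_infinite_iff_finite.1 hΓ
    have : NeZero t := ⟨by omega⟩
    exact hS <| hanti.finite_of_partiallyWellOrderedOn <|
      (BiasedGraph.partiallyWellOrderedOn_isLabellable Γ α β κ t).mono hlabellable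
  · intro _
    exact exists_infinite_antichain α β Γ κ ht
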